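/- For an irrational $x\in[0,1)$ write $x=[a_1,a_2,\dots]=\cfrac{1}{a_1+\cfrac{1}{a_2+\cdots}}$ for its regular continued fraction expansion; a rational number in $(0,1)$ is written in its reduced form $[a_1,\dots,a_n]$, $a_n\ge 2$. The Minkowski question mark measure $\mu_?$ is the probability measure on $[0,1)$ with distribution function $$?(x)=2\sum_{i\ge1}\frac{(-1)^{i+1}}{2^{a_1(x)+\cdots+a_i(x)}},$$ where the sum runs over the digits of $x$ (finitely many if $x$ is rational). For a block $d=d_1,\dots,d_k$ of positive integers, $k\ge1$, let $\Delta(d)$ be the set of $y\in[0,1)$ whose expansion starts with $d_1,\dots,d_k$, and let $G_n(x,d)$ be the number of occurrences of $d$ within the first $n$ continued fraction digits of $x$. A number $x\in[0,1)$ is called Minkowski normal if for every $k\ge1$ and every such block $d$ $$\lim_{n\to\infty}\frac1n\,G_n(x,d)=\mu_?(\Delta(d))=2^{-(d_1+\cdots+d_k)}.$$ The Farey tree is the infinite binary tree of rationals with root $1/2=[2]$ in which the node $[a_1,\dots,a_n]$ (reduced form) has the two children $[a_1,\dots,a_{n-1},a_n+1]$ and $[a_1,\dots,a_{n-1},a_n-1,2]$;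 the first is the left child and the second the right child if $n$ is odd, and the other way round if $n$ is even. Read top-down, left-right it lists the rationals $\frac12,\ \frac13,\frac23,\ \frac14,\frac25,\frac35,\frac34,\ \frac15,\dots$ **Theorem.** Concatenate the reduced continued fraction expansions of the rationals in the Farey tree, read top-down and left-right. The resulting infinite sequence of digits is the continued fraction expansion of an irrational number in $[0,1)$, namely the limit of its convergents, and this number is Minkowski normal. -/

import Mathlib

open Filter Topology MeasureTheory

noncomputable section

namespace MinkowskiNormality

/-! ### Continued fraction digits of a real number -/

/-- The digit `a_{n+1}(x)` (indexing from `0`) of the regular continued fraction expansion of `x`.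
The value `0`, which is never a digit, says that the expansion has at most `n` digits.
For rational `x` in `(0,1)` this is the reduced expansion, with last digit at least `2`. -/
def cfDigit (x : ℝ) (n : ℕ) : ℕ :=
  ⌊((GenContFract.of x).partDens.get? n).getD 0⌋₊

/-- The value `[a₁, …, aₙ] = 1 / (a₁ + 1 / (a₂ + ⋯))` of a finite list of digits. -/
def cfEval : List ℕ → ℝ
  | [] => 0
  | a :: t => 1 / ((a : ℝ) + cfEval t)

/-- The cylinder `Δ(d)`: all `y ∈ [0,1)` whose expansion starts with the block `d`. -/
def cylinder (d : List ℕ) : Set ℝ :=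
  {y | y ∈ Set.Ico (0 : ℝ) 1 ∧ ∀ j < d.length, cfDigit y j = d.getD j 0}

/-- `G_n(x, d)`: the number of occurrences of the block `d` within the first `n` continued
fraction digits of `x`. -/
def blockCount (n : ℕ) (x : ℝ) (d : List ℕ) : ℕ :=
  ((Finset.range n).filter fun i =>
    i + d.length ≤ n ∧ ∀ j < d.length, cfDigit x (i + j) = d.getD j 0).card

/-! ### The Minkowski question mark measure -/

/-- The summand `(-1)^(i+1) / 2^(a₁ + ⋯ + aᵢ)` (here with `i + 1` in place of `i`), present only
as long as the digit exists. -/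
def questionTerm (x : ℝ) (i : ℕ) : ℝ :=
  if cfDigit x i = 0 then 0
  else (-1) ^ (i + 2) / 2 ^ (∑ j ∈ Finset.range (i + 1), cfDigit x j)

/-- The Minkowski question mark function `?` on `[0,1)`. -/
def questionMark (x : ℝ) : ℝ := 2 * ∑' i, questionTerm x i

/-- The distribution function of the Minkowski question mark measure on the whole line. -/
def questionCDF (x : ℝ) : ℝ :=
  if x < 0 then 0 else if x < 1 then questionMark x else 1

lemma cfDigit_zero_eq (x : ℝ) : cfDigit x 0 = ⌊(Int.fract x)⁻¹⌋₊ := by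
  unfold cfDigit
  by_cases h : Int.fract x = 0
  · obtain ⟨a, rfl⟩ : ∃ a : ℤ, x = a := ⟨⌊x⌋, eq_of_sub_eq_zero h⟩
    have : (GenContFract.of (a : ℝ)).partDens.get? 0 = none := by
      rw [GenContFract.partDen_none_iff_s_none, GenContFract.of_s_of_int]; rfl
    rw [this]; simp
  · have h1 : (GenContFract.of x).s.get? 0 = some ⟨1, ⌊(Int.fract x)⁻¹⌋⟩ :=
      GenContFract.of_s_head h
    rw [GenContFract.partDen_eq_s_b h1]
    have : (0 : ℤ) ≤ ⌊(Int.fract x)⁻¹⌋ := Int.floor_nonneg.2 (inv_nonneg.2 (Int.fract_nonneg x))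
    simp only [Option.getD_some]
    rw [← natCast_floor_eq_intCast_floor (inv_nonneg.2 (Int.fract_nonneg x)), Nat.floor_natCast]

lemma cfDigit_succ (x : ℝ) (n : ℕ) : cfDigit x (n + 1) = cfDigit (Int.fract x)⁻¹ n := by
  unfold cfDigit GenContFract.partDens
  rw [Stream'.Seq.map_get?, Stream'.Seq.map_get?, GenContFract.of_s_succ]

lemma cfDigit_zero_left (n : ℕ) : cfDigit 0 n = 0 := by
  induction n with
  | zero => simp [cfDigit_zero_eq]
  | succ n ih => rw [cfDigit_succ]; simpa using ih

lemma fract_eq_zero_of_digit {x : ℝ} (h : cfDigit x 0 = 0) : Int.fract x = 0 := by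
  rw [cfDigit_zero_eq, Nat.floor_eq_zero] at h
  by_contra h0
  have h1 : 0 < Int.fract x := lt_of_le_of_ne (Int.fract_nonneg x) (Ne.symm h0)
  exact absurd ((one_lt_inv₀ h1).2 (Int.fract_lt_one x)) (not_lt.2 h.le)

lemma questionTerm_zero_left (i : ℕ) : questionTerm 0 i = 0 := by
  simp [questionTerm, cfDigit_zero_left]

lemma questionTerm_succ (x : ℝ) (i : ℕ) :
    questionTerm x (i + 1) = -(1 / 2 ^ cfDigit x 0) * questionTerm (Int.fract x)⁻¹ i := by
  unfold questionTerm
  rw [Finset.sum_range_succ' _ (i + 1)]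
  simp only [cfDigit_succ]
  split_ifs
  · simp
  · rw [pow_add 2, pow_succ (-1 : ℝ) (i + 2)]
    field_simp

lemma abs_questionTerm_le (x : ℝ) (i : ℕ) : |questionTerm x i| ≤ (1 / 2) ^ (i + 1) := by
  have key : ∀ x : ℝ, cfDigit x 0 ≠ 0 → (1 : ℝ) / 2 ^ cfDigit x 0 ≤ 1 / 2 := by
    intro x hx
    apply one_div_le_one_div_of_le (by norm_num)
    calc (2 : ℝ) = 2 ^ 1 := by norm_num
      _ ≤ 2 ^ cfDigit x 0 := pow_le_pow_right₀ (by norm_num) (Nat.one_le_iff_ne_zero.2 hx)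
  induction i generalizing x with
  | zero =>
    unfold questionTerm
    split_ifs with h
    · simp
    · simpa using key x h
  | succ i ih =>
    rw [questionTerm_succ]
    by_cases h : cfDigit x 0 = 0
    · rw [fract_eq_zero_of_digit h, inv_zero, questionTerm_zero_left]
      simp
    · rw [abs_mul, abs_neg, abs_of_pos (by positivity : (0 : ℝ) < 1 / 2 ^ cfDigit x 0), pow_succ' _ (i + 1)]
      exact mul_le_mul (key x h) (ih _) (abs_nonneg _) (by norm_num)

lemma summable_questionTerm (x : ℝ) : Summable (questionTerm x) := by
  have h : Summable fun i : ℕ => ((1 : ℝ) / 2) ^ (i + 1) :=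
    (summable_nat_add_iff 1).2 (summable_geometric_of_lt_one (by norm_num) (by norm_num))
  exact Summable.of_norm_bounded h (fun i => abs_questionTerm_le x i)

lemma questionSum_succ (x : ℝ) (h : cfDigit x 0 ≠ 0) (n : ℕ) :
    2 * ∑ i ∈ Finset.range (n + 1), questionTerm x i =
      1 / 2 ^ cfDigit x 0 *
        (2 - 2 * ∑ i ∈ Finset.range n, questionTerm (Int.fract x)⁻¹ i) := by
  rw [Finset.sum_range_succ']
  simp only [questionTerm_succ, ← Finset.mul_sum]
  have : questionTerm x 0 = 1 / 2 ^ cfDigit x 0 := by simp [questionTerm, h]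
  rw [this]; ring

lemma questionSum_of_digit_zero (x : ℝ) (h : cfDigit x 0 = 0) (n : ℕ) :
    2 * ∑ i ∈ Finset.range n, questionTerm x i = 0 := by
  have : ∀ i, questionTerm x i = 0 := by
    intro i
    cases i with
    | zero => simp [questionTerm, h]
    | succ i => rw [questionTerm_succ, fract_eq_zero_of_digit h, inv_zero, questionTerm_zero_left,
        mul_zero]
  simp [this]

lemma questionSum_mem (n : ℕ) (x : ℝ) :
    0 ≤ 2 * ∑ i ∈ Finset.range n, questionTerm x i ∧
      2 * ∑ i ∈ Finset.range n, questionTerm x i ≤ 1 := by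
  induction n generalizing x with
  | zero => simp
  | succ n ih =>
    by_cases h : cfDigit x 0 = 0
    · rw [questionSum_of_digit_zero x h]; norm_num
    · rw [questionSum_succ x h]
      obtain ⟨h0, h1⟩ := ih (Int.fract x)⁻¹
      have h2 : (2 : ℝ) ≤ 2 ^ cfDigit x 0 := by
        calc (2 : ℝ) = 2 ^ 1 := by norm_num
          _ ≤ 2 ^ cfDigit x 0 := pow_le_pow_right₀ (by norm_num) (Nat.one_le_iff_ne_zero.2 h)
      have h3 : (0 : ℝ) < 1 / 2 ^ cfDigit x 0 := by positivity
      have h4 : (1 : ℝ) / 2 ^ cfDigit x 0 ≤ 1 / 2 := one_div_le_one_div_of_le (by norm_num) h2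
      constructor
      · exact mul_nonneg h3.le (by linarith)
      · nlinarith

lemma questionSum_mono (n : ℕ) (x y : ℝ) (hxy : Int.fract x ≤ Int.fract y) :
    2 * ∑ i ∈ Finset.range n, questionTerm x i ≤ 2 * ∑ i ∈ Finset.range n, questionTerm y i := by
  induction n generalizing x y with
  | zero => simp
  | succ n ih =>
    by_cases hx : cfDigit x 0 = 0
    · rw [questionSum_of_digit_zero x hx]; exact (questionSum_mem _ y).1
    · have hfx : 0 < Int.fract x := by
        rcases (Int.fract_nonneg x).eq_or_lt with h | h
        · rw [cfDigit_zero_eq, ← h] at hx; simp at hx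
        · exact h
      have hinv : (Int.fract y)⁻¹ ≤ (Int.fract x)⁻¹ := inv_anti₀ hfx hxy
      have hfy : 0 < Int.fract y := hfx.trans_le hxy
      have hle : cfDigit y 0 ≤ cfDigit x 0 := by
        rw [cfDigit_zero_eq, cfDigit_zero_eq]; exact Nat.floor_le_floor hinv
      have hy : cfDigit y 0 ≠ 0 := fun h => hfy.ne' (fract_eq_zero_of_digit h)
      rw [questionSum_succ x hx, questionSum_succ y hy]
      obtain ⟨a0, a1⟩ := questionSum_mem n (Int.fract x)⁻¹
      obtain ⟨b0, b1⟩ := questionSum_mem n (Int.fract y)⁻¹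
      rcases hle.eq_or_lt with heq | hlt
      · rw [heq]
        have hf : Int.fract (Int.fract y)⁻¹ ≤ Int.fract (Int.fract x)⁻¹ := by
          have : (⌊(Int.fract y)⁻¹⌋ : ℤ) = ⌊(Int.fract x)⁻¹⌋ := by
            rw [cfDigit_zero_eq, cfDigit_zero_eq] at heq
            rw [← Int.natCast_floor_eq_floor (inv_nonneg.2 hfy.le),
              ← Int.natCast_floor_eq_floor (inv_nonneg.2 hfx.le), heq]
          unfold Int.fract at *
          rw [this]; linarith
        have := ih _ _ hf
        have h3 : (0 : ℝ) < 1 / 2 ^ cfDigit x 0 := by positivity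
        exact mul_le_mul_of_nonneg_left (by linarith) h3.le
      · have h3 : (0 : ℝ) < 1 / 2 ^ cfDigit x 0 := by positivity
        have h4 : (0 : ℝ) < 1 / 2 ^ cfDigit y 0 := by positivity
        have h5 : (2 : ℝ) * (1 / 2 ^ cfDigit x 0) ≤ 1 / 2 ^ cfDigit y 0 := by
          have : (2 : ℝ) ^ (cfDigit y 0 + 1) ≤ 2 ^ cfDigit x 0 :=
            pow_le_pow_right₀ (by norm_num) hlt
          rw [pow_succ] at this
          rw [mul_one_div, div_le_div_iff₀ (by positivity) (by positivity)]
          linarith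
        nlinarith

lemma tendsto_questionSum (x : ℝ) :
    Tendsto (fun n => 2 * ∑ i ∈ Finset.range n, questionTerm x i) atTop (𝓝 (questionMark x)) :=
  (summable_questionTerm x).hasSum.tendsto_sum_nat.const_mul 2

lemma questionCDF_mono : Monotone questionCDF := by
  have h0 : ∀ x, 0 ≤ questionMark x := fun x =>
    ge_of_tendsto' (tendsto_questionSum x) fun n => (questionSum_mem n x).1
  have h1 : ∀ x, questionMark x ≤ 1 := fun x =>
    le_of_tendsto' (tendsto_questionSum x) fun n => (questionSum_mem n x).2
  intro x y hxy
  unfold questionCDF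
  split_ifs with a b c d e f
  · exact le_rfl
  · exact h0 y
  · exact zero_le_one
  · linarith
  · refine le_of_tendsto_of_tendsto' (tendsto_questionSum x) (tendsto_questionSum y) fun n => ?_
    apply questionSum_mono
    rw [Int.fract_eq_self.2 ⟨not_lt.1 a, d⟩, Int.fract_eq_self.2 ⟨not_lt.1 e, f⟩]
    exact hxy
  · exact h1 x
  · linarith
  · linarith
  · exact le_rfl

/-- The Minkowski question mark measure `μ_?`: the Lebesgue–Stieltjes measure of its
distribution function. -/
def questionMeasure : Measure ℝ := questionCDF_mono.stieltjesFunction.measure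

/-- `x` is Minkowski normal if each nonempty block `d` of positive integers occurs among the
continued fraction digits of `x` with asymptotic frequency `μ_?(Δ(d)) = 2^{-(d₁ + ⋯ + d_k)}`. -/
def MinkowskiNormal (x : ℝ) : Prop :=
  x ∈ Set.Ico (0 : ℝ) 1 ∧
    ∀ d : List ℕ, d ≠ [] → (∀ a ∈ d, 0 < a) →
      Tendsto (fun n : ℕ => (blockCount n x d : ℝ) / n) atTop
        (𝓝 (questionMeasure (cylinder d)).toReal) ∧
      questionMeasure (cylinder d) = ENNReal.ofReal ((1 / 2) ^ d.sum)

/-! ### The Farey tree -/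

/-- `[a₁, …, aₙ] ↦ [a₁, …, aₙ + 1]`. -/
def incrLast (c : List ℕ) : List ℕ := c.dropLast ++ [c.getLastD 0 + 1]

/-- `[a₁, …, aₙ] ↦ [a₁, …, aₙ - 1, 2]`. -/
def splitLast (c : List ℕ) : List ℕ := c.dropLast ++ [c.getLastD 0 - 1, 2]

/-- The two children, left to right, of a rational in the Farey tree, each rational being
given by the digits of its reduced continued fraction expansion. -/
def fareyChildren (c : List ℕ) : List (List ℕ) :=
  if Odd c.length then [incrLast c, splitLast c] else [splitLast c, incrLast c]

/-- Level `l` of the Farey tree, left to right; the root is `1/2 = [2]`. -/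
def fareyLevel : ℕ → List (List ℕ)
  | 0 => [[2]]
  | l + 1 => (fareyLevel l).flatMap fareyChildren

/-- The concatenation of all expansions in the levels `0, …, L - 1`, top-down, left-right. -/
def fareyPrefix : ℕ → List ℕ
  | 0 => []
  | L + 1 => fareyPrefix L ++ (fareyLevel L).flatten

/-- The infinite concatenation of the expansions in the Farey tree. The first `n + 1` levels
contain more than `n` digits, see `lt_length_fareyPrefix`. -/
def fareyDigit (n : ℕ) : ℕ := (fareyPrefix (n + 1)).getD n 0

lemma fareyLevel_flatten_ne_nil (l : ℕ) :
    fareyLevel l ≠ [] ∧ ∀ c ∈ fareyLevel l, c ≠ [] := by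
  induction l with
  | zero => simp [fareyLevel]
  | succ l ih =>
    obtain ⟨h1, h2⟩ := ih
    constructor
    · obtain ⟨c, t, h⟩ := List.exists_cons_of_ne_nil h1
      rw [fareyLevel, h, List.flatMap_cons]
      unfold fareyChildren
      split_ifs <;> simp
    · intro c hc
      rw [fareyLevel, List.mem_flatMap] at hc
      obtain ⟨b, -, hb⟩ := hc
      unfold fareyChildren incrLast splitLast at hb
      split_ifs at hb <;> simp at hb <;> rcases hb with rfl | rfl <;> simp

lemma lt_length_fareyPrefix (n : ℕ) : n < (fareyPrefix (n + 1)).length := by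
  have key : ∀ L, L ≤ (fareyPrefix L).length := by
    intro L
    induction L with
    | zero => simp
    | succ L ih =>
      obtain ⟨h1, h2⟩ := fareyLevel_flatten_ne_nil L
      obtain ⟨c, t, h⟩ := List.exists_cons_of_ne_nil h1
      have hc : c ≠ [] := h2 c (by simp [h])
      have := List.length_pos_iff.2 hc
      rw [fareyPrefix, List.length_append, h, List.flatten_cons, List.length_append]
      omega
  exact key (n + 1)

/-- The finite continued fraction given by the first `n` digits of the concatenation. -/
def fareyConvergent (n : ℕ) : ℝ := cfEval ((List.range n).map fareyDigit)

/-- The value of the infinite continued fraction whose digits are the concatenation of the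
expansions in the Farey tree, as the limit of its convergents. -/
def fareyNumber : ℝ := limUnder atTop fareyConvergent

end MinkowskiNormality

end

namespace MinkowskiNormality

/-! ### Values of continued fractions -/

/-! Walk down the Farey tree from the root, choosing either child with probability 1/2. Write a node
as `u, r + 1`. Its children are `u, r + 2` and `u, r, 2`, so each step either adds a unit to the
open digit or closes it at `r` and opens a new one. The closed digits behave like independent ones
with `P(a) = 2^{-a}`, which is the digit law of the question mark measure.

Normality follows by induction on the block: it suffices that `d, a` occurs `2^{-a}` times as often
as `d`, up to `o(n)`. Corrected for the open digit, the difference of the two counts is a martingale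
with increments at most 1 (`martingaleDev_add`, `martingaleDev_sq_add_sq_le`). Hence its mean square
on level `l` is at most `l + 1` (`sum_nodeDev_sq_le`), while the mean length of an expansion there
is `(l + 2) / 2` (`sum_length_fareyLevel`). Occurrences across two expansions and the one cut
expansion cost little, so the deviation is negligible (`abs_deviation_fareyDigit_le`). The order
within a level plays no role.

The measure of a cylinder comes from `?(1/(a+z)) = (2 - ?(z)) / 2^a` and the continuity of `?`. -/

lemma abs_one_div_add_sub_le {a x y δ : ℝ} (ha : 1 ≤ a) (hx : 0 ≤ x) (hy : 0 ≤ y)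
    (h : |x - y| ≤ δ) : |1 / (a + x) - 1 / (a + y)| ≤ δ / (1 + δ) := by
  have hδ : 0 ≤ δ := (abs_nonneg _).trans h
  have hxa : 0 < a + x := by linarith
  have hya : 0 < a + y := by linarith
  rw [div_sub_div _ _ hxa.ne' hya.ne', abs_div, abs_of_pos (mul_pos hxa hya),
    div_le_div_iff₀ (mul_pos hxa hya) (by linarith)]
  have h1 : 1 * (a + y) - (a + x) * 1 = -(x - y) := by ring
  rw [h1, abs_neg]
  -- The denominator is at least `1 + x + y`; the bound then follows since `s / (1 + s)` increases
  -- with `s`.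
  have h2 : 1 + |x - y| ≤ (a + x) * (a + y) := by
    have : |x - y| ≤ x + y := abs_le.2 ⟨by linarith, by linarith⟩
    nlinarith [mul_nonneg hx hy]
  nlinarith

lemma cfEval_mem {c : List ℕ} (hc : ∀ a ∈ c, 1 ≤ a) : 0 ≤ cfEval c ∧ cfEval c ≤ 1 := by
  induction c with
  | nil => simp [cfEval]
  | cons a t ih =>
    obtain ⟨h0, -⟩ := ih fun b hb => hc b (List.mem_cons_of_mem _ hb)
    have ha : (1 : ℝ) ≤ a := by exact_mod_cast hc a List.mem_cons_self
    rw [cfEval]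
    exact ⟨by positivity, (div_le_one (by linarith)).2 (by linarith)⟩

/-- Each common digit improves the bound by `δ ↦ δ / (1 + δ)`, which sends `1 / m` to `1 / (m + 1)`;
the start is `δ = 1`. -/
lemma abs_cfEval_append_sub_le {u s t : List ℕ} (hu : ∀ a ∈ u, 1 ≤ a) (hs : ∀ a ∈ s, 1 ≤ a)
    (ht : ∀ a ∈ t, 1 ≤ a) :
    |cfEval (u ++ s) - cfEval (u ++ t)| ≤ 1 / ((u.length : ℝ) + 1) := by
  induction u with
  | nil =>
    have h1 := cfEval_mem hs
    have h2 := cfEval_mem ht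
    simpa using abs_le.2 ⟨by linarith, by linarith⟩
  | cons a u ih =>
    have hu' : ∀ b ∈ u, 1 ≤ b := fun b hb => hu b (List.mem_cons_of_mem _ hb)
    have ha : (1 : ℝ) ≤ a := by exact_mod_cast hu a List.mem_cons_self
    have hmem : ∀ v : List ℕ, (∀ b ∈ v, 1 ≤ b) → ∀ b ∈ u ++ v, 1 ≤ b := by
      intro v hv b hb
      rcases List.mem_append.1 hb with h | h
      exacts [hu' b h, hv b h]
    have := abs_one_div_add_sub_le ha (cfEval_mem (hmem s hs)).1 (cfEval_mem (hmem t ht)).1 (ih hu')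
    simp only [List.cons_append, cfEval]
    refine this.trans (le_of_eq ?_)
    push_cast [List.length_cons]
    field_simp

lemma range_map_add (w : ℕ → ℕ) (N m : ℕ) : (List.range (N + m)).map w =
    (List.range N).map w ++ (List.range m).map fun i => w (N + i) := by
  rw [List.range_add, List.map_append, List.map_map]; rfl

lemma exists_tendsto_cfEval {w : ℕ → ℕ} (hw : ∀ n, 1 ≤ w n) :
    ∃ x, Tendsto (fun n => cfEval ((List.range n).map w)) atTop (𝓝 x) := by
  have hpos : ∀ (v : ℕ → ℕ), (∀ n, 1 ≤ v n) → ∀ n, ∀ a ∈ (List.range n).map v, 1 ≤ a := by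
    intro v hv n a ha
    obtain ⟨i, -, rfl⟩ := List.mem_map.1 ha
    exact hv i
  have hlim : Tendsto (fun N : ℕ => 1 / ((N : ℝ) + 1)) atTop (𝓝 0) :=
    tendsto_one_div_add_atTop_nhds_zero_nat
  refine cauchySeq_tendsto_of_complete (cauchySeq_of_le_tendsto_0 _ ?_ hlim)
  intro n m N hn hm
  obtain ⟨i, rfl⟩ := Nat.exists_eq_add_of_le hn
  obtain ⟨j, rfl⟩ := Nat.exists_eq_add_of_le hm
  rw [Real.dist_eq, range_map_add, range_map_add]
  simpa using abs_cfEval_append_sub_le (hpos w hw N)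
    (hpos (fun i => w (N + i)) (fun i => hw _) i) (hpos (fun i => w (N + i)) (fun i => hw _) j)

/-- The value of the infinite continued fraction with digits `w`. -/
noncomputable def cfLim (w : ℕ → ℕ) : ℝ := limUnder atTop fun n => cfEval ((List.range n).map w)

lemma tendsto_cfLim {w : ℕ → ℕ} (hw : ∀ n, 1 ≤ w n) :
    Tendsto (fun n => cfEval ((List.range n).map w)) atTop (𝓝 (cfLim w)) :=
  tendsto_nhds_limUnder (exists_tendsto_cfEval hw)

lemma cfLim_nonneg {w : ℕ → ℕ} (hw : ∀ n, 1 ≤ w n) : 0 ≤ cfLim w := by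
  refine ge_of_tendsto' (tendsto_cfLim hw) fun n => (cfEval_mem ?_).1
  intro a ha
  obtain ⟨i, -, rfl⟩ := List.mem_map.1 ha
  exact hw i

lemma cfLim_eq {w : ℕ → ℕ} (hw : ∀ n, 1 ≤ w n) :
    cfLim w = 1 / ((w 0 : ℝ) + cfLim fun n => w (n + 1)) := by
  have hw' : ∀ n, 1 ≤ w (n + 1) := fun n => hw _
  have h0 : (1 : ℝ) ≤ w 0 := by exact_mod_cast hw 0
  have h1 := (tendsto_cfLim hw).comp (tendsto_add_atTop_nat 1)
  have h2 := (tendsto_const_nhds (x := (1 : ℝ))).div ((tendsto_cfLim hw').const_add (w 0 : ℝ))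
    (by linarith [cfLim_nonneg hw'])
  refine tendsto_nhds_unique h1 (h2.congr fun n => ?_)
  simp [List.range_succ_eq_map, cfEval, Function.comp_def]

lemma cfLim_mem_Ioo {w : ℕ → ℕ} (hw : ∀ n, 1 ≤ w n) : cfLim w ∈ Set.Ioo (0 : ℝ) 1 := by
  have pos : ∀ {w : ℕ → ℕ}, (∀ n, 1 ≤ w n) → 0 < cfLim w := by
    intro w hw
    have hw' : ∀ n, 1 ≤ w (n + 1) := fun n => hw _
    have h0 : (1 : ℝ) ≤ w 0 := by exact_mod_cast hw 0
    rw [cfLim_eq hw]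
    have := cfLim_nonneg hw'
    positivity
  refine ⟨pos hw, ?_⟩
  have hw' : ∀ n, 1 ≤ w (n + 1) := fun n => hw _
  have h0 : (1 : ℝ) ≤ w 0 := by exact_mod_cast hw 0
  have := pos hw'
  rw [cfLim_eq hw, div_lt_one (by linarith)]
  linarith

lemma cfDigit_fract (x : ℝ) (n : ℕ) : cfDigit (Int.fract x) n = cfDigit x n := by
  cases n with
  | zero => rw [cfDigit_zero_eq, cfDigit_zero_eq, Int.fract_fract]
  | succ n => rw [cfDigit_succ, cfDigit_succ, Int.fract_fract]

lemma cfDigit_cfLim {w : ℕ → ℕ} (hw : ∀ n, 1 ≤ w n) (n : ℕ) : cfDigit (cfLim w) n = w n := by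
  have key : ∀ {w : ℕ → ℕ}, (∀ n, 1 ≤ w n) →
      (Int.fract (cfLim w))⁻¹ = (w 0 : ℝ) + cfLim fun n => w (n + 1) := by
    intro w hw
    have h := cfLim_mem_Ioo hw
    rw [Int.fract_eq_self.2 ⟨h.1.le, h.2⟩, cfLim_eq hw, one_div, inv_inv]
  induction n generalizing w with
  | zero =>
    have h := cfLim_mem_Ioo fun n => hw (n + 1)
    rw [cfDigit_zero_eq, key hw, add_comm, Nat.floor_add_natCast h.1.le, Nat.floor_eq_zero.2 h.2, zero_add]
  | succ n ih =>
    have h := cfLim_mem_Ioo fun n => hw (n + 1)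
    rw [cfDigit_succ, key hw, ← cfDigit_fract, Int.fract_natCast_add,
      Int.fract_eq_self.2 ⟨h.1.le, h.2⟩, ih fun n => hw (n + 1)]

/-- The expansion of a rational terminates, which would produce the value `0` among the digits. -/
lemma irrational_cfLim {w : ℕ → ℕ} (hw : ∀ n, 1 ≤ w n) : Irrational (cfLim w) := by
  rintro ⟨q, hq⟩
  obtain ⟨n, hn⟩ := (GenContFract.terminates_iff_rat (cfLim w)).2 ⟨q, hq.symm⟩
  have h : cfDigit (cfLim w) n = 0 := by
    unfold cfDigit
    rw [GenContFract.partDen_none_iff_s_none.2 hn]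
    simp
  have := hw n
  rw [cfDigit_cfLim hw] at h
  omega

/-! ### The question mark measure of a cylinder -/

lemma questionMark_of_digit {x : ℝ} (h : cfDigit x 0 ≠ 0) :
    questionMark x = 1 / 2 ^ cfDigit x 0 * (2 - questionMark (Int.fract x)⁻¹) := by
  have h1 := (tendsto_questionSum x).comp (tendsto_add_atTop_nat 1)
  have h2 := ((tendsto_questionSum (Int.fract x)⁻¹).const_sub 2).const_mul (1 / 2 ^ cfDigit x 0)
  exact tendsto_nhds_unique h1 (h2.congr fun n => (questionSum_succ x h n).symm)

lemma questionMark_fract (x : ℝ) : questionMark (Int.fract x) = questionMark x := by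
  simp [questionMark, questionTerm, cfDigit_fract]

lemma questionMark_zero : questionMark 0 = 0 := by
  simp [questionMark, questionTerm_zero_left]

lemma questionCDF_of_mem_Ico {x : ℝ} (h : x ∈ Set.Ico (0 : ℝ) 1) :
    questionCDF x = questionMark x := by
  rw [questionCDF, if_neg (not_lt.2 h.1), if_pos h.2]

lemma questionCDF_zero : questionCDF 0 = 0 := by
  rw [questionCDF_of_mem_Ico ⟨le_rfl, one_pos⟩, questionMark_zero]

lemma questionCDF_one : questionCDF 1 = 1 := by
  norm_num [questionCDF]

lemma questionCDF_mem (x : ℝ) : questionCDF x ∈ Set.Icc (0 : ℝ) 1 := by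
  constructor
  · calc (0 : ℝ) = questionCDF (min x (-1)) := by
          rw [questionCDF, if_pos (by linarith [min_le_right x (-1)])]
      _ ≤ _ := questionCDF_mono (min_le_left _ _)
  · calc questionCDF x ≤ questionCDF (max x 1) := questionCDF_mono (le_max_left _ _)
      _ = 1 := by
          have := le_max_right x 1
          rw [questionCDF, if_neg (by linarith), if_neg (by linarith)]

/-- The functional equation of the question mark function. -/
lemma questionCDF_one_div_add {a : ℕ} (ha : 1 ≤ a) {z : ℝ} (hz : z ∈ Set.Icc (0 : ℝ) 1) :
    questionCDF (1 / (a + z)) = (2 - questionCDF z) / 2 ^ a := by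
  have main : ∀ {a : ℕ} {z : ℝ}, 1 ≤ a → z ∈ Set.Ico (0 : ℝ) 1 → 1 < a + z →
      questionCDF (1 / (a + z)) = (2 - questionCDF z) / 2 ^ a := by
    intro a z ha hz h1
    have hmem : 1 / ((a : ℝ) + z) ∈ Set.Ico (0 : ℝ) 1 :=
      ⟨by positivity, (div_lt_one (by linarith)).2 h1⟩
    have hf : (Int.fract (1 / ((a : ℝ) + z)))⁻¹ = a + z := by
      rw [Int.fract_eq_self.2 hmem, one_div, inv_inv]
    have hd : cfDigit (1 / ((a : ℝ) + z)) 0 = a := by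
      rw [cfDigit_zero_eq, hf, add_comm, Nat.floor_add_natCast hz.1, Nat.floor_eq_zero.2 hz.2,
        zero_add]
    rw [questionCDF_of_mem_Ico hmem, questionCDF_of_mem_Ico hz, questionMark_of_digit (by omega),
      hf, hd, ← questionMark_fract, Int.fract_natCast_add, Int.fract_eq_self.2 hz]
    ring
  have ha' : (1 : ℝ) ≤ a := by exact_mod_cast ha
  rcases hz.2.eq_or_lt with rfl | hz1
  -- `1 / (a + 1)` is read with digit `a + 1` and remainder `0`.
  · have := main (a := a + 1) (z := 0) (by omega) ⟨le_rfl, one_pos⟩ (by push_cast; linarith)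
    rw [questionCDF_zero] at this
    push_cast at this
    rw [add_zero] at this
    rw [this, questionCDF_one, pow_succ]
    field_simp
    norm_num
  · rcases (show (1 : ℝ) ≤ a + z by linarith [hz.1]).eq_or_lt with h | h
    · have hz0 : z = 0 := by linarith [hz.1]
      have ha1 : a = 1 := by
        have : (a : ℝ) = 1 := by linarith
        exact_mod_cast this
      subst hz0 ha1
      norm_num [questionCDF_zero, questionCDF_one]
    · exact main ha ⟨hz.1, hz1⟩ h

/-! ### Dyadic values and continuity of the question mark function -/

lemma exists_questionCDF_half {v : ℝ} (hv : ∃ x ∈ Set.Icc (0 : ℝ) 1, questionCDF x = v) :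
    ∃ x ∈ Set.Icc (0 : ℝ) 1, questionCDF x = v / 2 := by
  obtain ⟨x, hx, rfl⟩ := hv
  rcases hx.1.eq_or_lt with rfl | h0
  · exact ⟨0, hx, by simp [questionCDF_zero]⟩
  · have hinv : 1 ≤ x⁻¹ := (one_le_inv₀ h0).2 hx.2
    have hfl : 1 ≤ ⌊x⁻¹⌋₊ := Nat.one_le_floor_iff _ |>.2 hinv
    have hz : x⁻¹ - ⌊x⁻¹⌋₊ ∈ Set.Icc (0 : ℝ) 1 :=
      ⟨by linarith [Nat.floor_le (zero_le_one.trans hinv)], by linarith [Nat.lt_floor_add_one x⁻¹]⟩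
    have h1 := questionCDF_one_div_add hfl hz
    -- Raising the first digit by one doubles the denominator in the functional equation.
    have h2 := questionCDF_one_div_add (a := ⌊x⁻¹⌋₊ + 1) (by omega) hz
    rw [add_sub_cancel, one_div, inv_inv] at h1
    have h3 : 1 ≤ ((⌊x⁻¹⌋₊ + 1 : ℕ) : ℝ) + (x⁻¹ - ⌊x⁻¹⌋₊) := by push_cast; linarith
    refine ⟨_, ⟨by positivity, (div_le_one (by linarith)).2 h3⟩, h2.trans ?_⟩
    rw [h1, pow_succ]
    field_simp

lemma exists_questionCDF_one_sub_half {v : ℝ}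
    (hv : ∃ x ∈ Set.Icc (0 : ℝ) 1, questionCDF x = v) :
    ∃ x ∈ Set.Icc (0 : ℝ) 1, questionCDF x = 1 - v / 2 := by
  obtain ⟨x, hx, rfl⟩ := hv
  have h := questionCDF_one_div_add le_rfl hx
  have h0 : (0 : ℝ) < ((1 : ℕ) : ℝ) + x := by push_cast; linarith [hx.1]
  refine ⟨_, ⟨by positivity, (div_le_one h0).2 (by push_cast; linarith [hx.1])⟩, h.trans ?_⟩
  ring

/-- The maps `v ↦ v / 2` and `v ↦ 1 - v / 2` preserve the set of values; from `0` and `1` they reach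
the dyadics of the lower and of the upper half of the unit interval, respectively. -/
lemma exists_questionCDF_dyadic (n m : ℕ) (hm : m ≤ 2 ^ n) :
    ∃ x ∈ Set.Icc (0 : ℝ) 1, questionCDF x = m / 2 ^ n := by
  induction n generalizing m with
  | zero =>
    interval_cases h : m
    · exact ⟨0, ⟨le_rfl, zero_le_one⟩, by simp [questionCDF_zero]⟩
    · exact ⟨1, ⟨zero_le_one, le_rfl⟩, by simp [questionCDF_one]⟩
  | succ n ih =>
    rw [pow_succ] at hm
    by_cases h : m ≤ 2 ^ n
    · obtain ⟨x, hx, he⟩ := exists_questionCDF_half (ih m h)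
      exact ⟨x, hx, he.trans (by rw [pow_succ]; field_simp)⟩
    · obtain ⟨x, hx, he⟩ := exists_questionCDF_one_sub_half (ih (2 * 2 ^ n - m) (by omega))
      refine ⟨x, hx, he.trans ?_⟩
      rw [Nat.cast_sub (by omega), pow_succ]
      push_cast
      field_simp
      ring

lemma exists_questionCDF_mem_Ioo {a b : ℝ} (ha : 0 ≤ a) (hab : a < b) (hb : b ≤ 1) :
    ∃ x ∈ Set.Ico (0 : ℝ) 1, questionCDF x ∈ Set.Ioo a b := by
  obtain ⟨n, hn⟩ := exists_pow_lt_of_lt_one (sub_pos.2 hab) (by norm_num : (1 / 2 : ℝ) < 1)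
  rw [one_div, inv_pow] at hn
  have h2 : (0 : ℝ) < 2 ^ n := by positivity
  have hlt : a * 2 ^ n < (⌊a * 2 ^ n⌋₊ + 1 : ℕ) := by
    push_cast; exact Nat.lt_floor_add_one _
  have hle : ((⌊a * 2 ^ n⌋₊ + 1 : ℕ) : ℝ) < b * 2 ^ n := by
    have h3 := Nat.floor_le (mul_nonneg ha h2.le)
    have h4 := mul_lt_mul_of_pos_right hn h2
    rw [inv_mul_cancel₀ h2.ne'] at h4
    push_cast
    linarith
  have hm : ⌊a * 2 ^ n⌋₊ + 1 ≤ 2 ^ n := by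
    have : ((⌊a * 2 ^ n⌋₊ + 1 : ℕ) : ℝ) ≤ (2 ^ n : ℕ) := by
      push_cast at hle ⊢
      nlinarith
    exact_mod_cast this
  obtain ⟨x, hx, he⟩ := exists_questionCDF_dyadic n _ hm
  have hmem : questionCDF x ∈ Set.Ioo a b := by
    rw [he]
    exact ⟨(lt_div_iff₀ h2).2 hlt, (div_lt_iff₀ h2).2 hle⟩
  refine ⟨x, ⟨hx.1, lt_of_le_of_ne hx.2 ?_⟩, hmem⟩
  rintro rfl
  rw [questionCDF_one] at hmem
  linarith [hmem.2]

/-- A monotone function with dense range is continuous. To make the range dense in the whole line,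
the function is replaced by the identity outside `[0,1)`; clamping to `[0,1]` recovers it. -/
lemma continuous_questionCDF : Continuous questionCDF := by
  let g : ℝ → ℝ := fun x => if x < 0 then x else if x < 1 then questionCDF x else x
  have hmono : Monotone g := by
    intro x y hxy
    have hx := questionCDF_mem x
    have hy := questionCDF_mem y
    have := questionCDF_mono hxy
    simp only [g]
    split_ifs <;> linarith [hx.1, hx.2, hy.1, hy.2]
  have hdense : DenseRange g := by
    refine dense_of_exists_between fun {a b} hab => ?_
    by_cases ha : a < 0
    · have h0 : a < min b 0 := lt_min hab ha
      obtain ⟨c, hc1, hc2⟩ := exists_between h0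
      refine ⟨c, ⟨c, ?_⟩, hc1, hc2.trans_le (min_le_left _ _)⟩
      simp only [g]
      rw [if_pos (hc2.trans_le (min_le_right _ _))]
    · by_cases hb : 1 < b
      · have h0 : max a 1 < b := max_lt hab hb
        obtain ⟨c, hc1, hc2⟩ := exists_between h0
        refine ⟨c, ⟨c, ?_⟩, (le_max_left _ _).trans_lt hc1, hc2⟩
        have := (le_max_right a 1).trans_lt hc1
        simp only [g]
        rw [if_neg (by linarith), if_neg (by linarith)]
      · obtain ⟨x, hx, hm⟩ := exists_questionCDF_mem_Ioo (not_lt.1 ha) hab (not_lt.1 hb)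
        refine ⟨_, ⟨x, ?_⟩, hm⟩
        simp only [g]
        rw [if_neg (not_lt.2 hx.1), if_pos hx.2]
  have hg := hmono.continuous_of_denseRange hdense
  have : questionCDF = fun x => max 0 (min 1 (g x)) := by
    funext x
    have hx := questionCDF_mem x
    simp only [g]
    split_ifs with h1 h2
    · rw [min_eq_right (by linarith), max_eq_left h1.le, questionCDF, if_pos h1]
    · rw [min_eq_right hx.2, max_eq_right hx.1]
    · rw [min_eq_left (by linarith), max_eq_right zero_le_one, questionCDF, if_neg h1, if_neg h2]
  rw [this]
  fun_prop

lemma stieltjesFunction_questionCDF (x : ℝ) :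
    questionCDF_mono.stieltjesFunction x = questionCDF x := by
  rw [Monotone.stieltjesFunction_eq]
  exact (continuous_questionCDF.continuousAt.continuousWithinAt).rightLim_eq

lemma leftLim_stieltjesFunction_questionCDF (x : ℝ) :
    Function.leftLim questionCDF_mono.stieltjesFunction x = questionCDF x := by
  have : (questionCDF_mono.stieltjesFunction : ℝ → ℝ) = questionCDF :=
    funext stieltjesFunction_questionCDF
  rw [this]
  exact (continuous_questionCDF.continuousAt.continuousWithinAt).leftLim_eq

lemma questionMeasure_Icc (p q : ℝ) :
    questionMeasure (Set.Icc p q) = ENNReal.ofReal (questionCDF q - questionCDF p) := by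
  rw [questionMeasure, StieltjesFunction.measure_Icc, stieltjesFunction_questionCDF,
    leftLim_stieltjesFunction_questionCDF]

lemma questionMeasure_Ioo (p q : ℝ) :
    questionMeasure (Set.Ioo p q) = ENNReal.ofReal (questionCDF q - questionCDF p) := by
  rw [questionMeasure, StieltjesFunction.measure_Ioo, stieltjesFunction_questionCDF,
    leftLim_stieltjesFunction_questionCDF]

/-! ### Cylinders as intervals -/

lemma mem_cylinder_cons {a : ℕ} {d : List ℕ} {y : ℝ} : y ∈ cylinder (a :: d) ↔
    y ∈ Set.Ico (0 : ℝ) 1 ∧ ⌊y⁻¹⌋₊ = a ∧ Int.fract y⁻¹ ∈ cylinder d := by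
  simp only [cylinder, Set.mem_ofPred_eq, List.length_cons]
  refine and_congr_right fun hy => ?_
  have hf : Int.fract y = y := Int.fract_eq_self.2 hy
  constructor
  · intro h
    refine ⟨?_, ⟨Int.fract_nonneg _, Int.fract_lt_one _⟩, fun j hj => ?_⟩
    · have := h 0 (by omega)
      rwa [cfDigit_zero_eq, hf] at this
    · have := h (j + 1) (by omega)
      rwa [cfDigit_succ, hf, ← cfDigit_fract] at this
  · rintro ⟨h0, -, h1⟩ j hj
    cases j with
    | zero => rw [cfDigit_zero_eq, hf]; exact h0
    | succ j => rw [cfDigit_succ, hf, ← cfDigit_fract]; exact h1 j (by omega)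

/-- Prepending `a` applies `z ↦ 1 / (a + z)`, which reverses the endpoints and scales the increment
of `?` by `2^{-a}`. Which endpoints belong to the cylinder is left open, as points have measure
zero. -/
lemma exists_Ioo_subset_cylinder {d : List ℕ} (hd : ∀ a ∈ d, 0 < a) :
    ∃ p q : ℝ, 0 ≤ p ∧ p ≤ q ∧ q ≤ 1 ∧ Set.Ioo p q ⊆ cylinder d ∧ cylinder d ⊆ Set.Icc p q ∧
      questionCDF q - questionCDF p = (1 / 2) ^ d.sum := by
  induction d with
  | nil =>
    refine ⟨0, 1, le_rfl, zero_le_one, le_rfl, fun y hy => ⟨⟨hy.1.le, hy.2⟩, by simp⟩,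
      fun y hy => ⟨hy.1.1, hy.1.2.le⟩, by simp [questionCDF_zero, questionCDF_one]⟩
  | cons a d ih =>
    obtain ⟨p, q, hp, hpq, hq, h1, h2, h3⟩ := ih fun b hb => hd b (List.mem_cons_of_mem _ hb)
    have ha : 1 ≤ a := hd a List.mem_cons_self
    have ha' : (1 : ℝ) ≤ a := by exact_mod_cast ha
    have hap : (0 : ℝ) < a + p := by linarith
    have haq : (0 : ℝ) < a + q := by linarith
    refine ⟨1 / (a + q), 1 / (a + p), by positivity,
      one_div_le_one_div_of_le hap (by linarith), (div_le_one hap).2 (by linarith), ?_, ?_, ?_⟩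
    · intro y hy
      have hy0 : 0 < y := lt_trans (by positivity) hy.1
      have hy1 : a + p < y⁻¹ := by
        rw [lt_inv_comm₀ hap hy0, ← one_div]; exact hy.2
      have hy2 : y⁻¹ < a + q := by
        rw [inv_lt_comm₀ hy0 haq, ← one_div]; exact hy.1
      have hfl : ⌊y⁻¹⌋ = (a : ℤ) := Int.floor_eq_iff.2
        ⟨by push_cast; linarith, by push_cast; linarith⟩
      have hfl' : ⌊y⁻¹⌋₊ = a := (Nat.floor_eq_iff (by positivity)).2 ⟨by linarith, by linarith⟩
      refine mem_cylinder_cons.2 ⟨⟨hy0.le, hy.2.trans_le ((div_le_one hap).2 (by linarith))⟩,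
        hfl', h1 ?_⟩
      rw [Int.fract, hfl]
      push_cast
      exact ⟨by linarith, by linarith⟩
    · intro y hy
      obtain ⟨hy, hfl, hfr⟩ := mem_cylinder_cons.1 hy
      have hy0 : 0 < y := by
        -- For `y = 0` the convention `0⁻¹ = 0` gives first digit `0`, contrary to `1 ≤ a`.
        rcases hy.1.eq_or_lt with rfl | h
        · simp at hfl; omega
        · exact h
      obtain ⟨h4, h5⟩ := h2 hfr
      have hi : (0 : ℝ) ≤ y⁻¹ := by positivity
      rw [Int.fract, ← natCast_floor_eq_intCast_floor hi, hfl] at h4 h5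
      constructor
      · rw [one_div, inv_le_comm₀ haq hy0]; linarith
      · rw [one_div, le_inv_comm₀ hy0 hap]; linarith
    · rw [questionCDF_one_div_add ha ⟨hp, hpq.trans hq⟩,
        questionCDF_one_div_add ha ⟨hp.trans hpq, hq⟩, List.sum_cons, pow_add, ← h3, one_div_pow]
      ring

lemma questionMeasure_cylinder {d : List ℕ} (hd : ∀ a ∈ d, 0 < a) :
    questionMeasure (cylinder d) = ENNReal.ofReal ((1 / 2) ^ d.sum) := by
  obtain ⟨p, q, -, -, -, h1, h2, h3⟩ := exists_Ioo_subset_cylinder hd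
  rw [← h3]
  exact le_antisymm ((measure_mono h2).trans_eq (questionMeasure_Icc p q))
    ((questionMeasure_Ioo p q).symm.trans_le (measure_mono h1))

/-! ### Occurrences of a block in a list -/

/-- The number of occurrences of the block `d` in the list `c`, counted by their last position. -/
def occ (d c : List ℕ) : ℕ :=
  ((Finset.range c.length).filter fun i => d <:+ c.take (i + 1)).card

lemma occ_nil_right (d : List ℕ) : occ d [] = 0 := rfl

lemma occ_nil_left (c : List ℕ) : occ [] c = c.length := by
  simp [occ]

lemma occ_le_length (d c : List ℕ) : occ d c ≤ c.length :=
  (Finset.card_filter_le _ _).trans_eq (Finset.card_range _)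

lemma occ_concat (d c : List ℕ) (r : ℕ) :
    occ d (c ++ [r]) = occ d c + if d <:+ c ++ [r] then 1 else 0 := by
  simp only [occ, Finset.card_filter, List.length_append, List.length_singleton,
    Finset.sum_range_succ]
  congr 1
  · refine Finset.sum_congr rfl fun i hi => ?_
    rw [List.take_append_of_le_length (Finset.mem_range.1 hi)]
  · rw [List.take_of_length_le (by simp)]

/-- Only occurrences across the seam are new, and they end near the start of `y`. The minimum with
`y.length` lets the induction on `y` pay for each of them. -/
lemma occ_append (d x y : List ℕ) :
    occ d x + occ d y ≤ occ d (x ++ y) ∧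
      occ d (x ++ y) ≤ occ d x + occ d y + min y.length d.length := by
  induction y using List.reverseRecOn with
  | nil => simp [occ_nil_right]
  | append_singleton y r ih =>
    rw [← List.append_assoc, occ_concat, occ_concat, List.append_assoc, List.length_append,
      List.length_singleton]
    by_cases h : d <:+ y ++ [r]
    · rw [if_pos h, if_pos (List.suffix_append_of_suffix h)]
      omega
    · rw [if_neg h]
      split_ifs with h'
      · have : y.length + 1 < d.length := by
          by_contra! hlen
          refine h (List.suffix_of_suffix_length_le h' (List.suffix_append x _) ?_)
          simpa using hlen
        omega
      · omega

/-- The deviation of the number of occurrences of `d, a` from the expected share `2^{-a}` of the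
occurrences of `d`. -/
noncomputable def deviation (d : List ℕ) (a : ℕ) (c : List ℕ) : ℝ :=
  occ (d ++ [a]) c - (1 / 2) ^ a * occ d c

lemma half_pow_mem (a : ℕ) : 0 ≤ (1 / 2 : ℝ) ^ a ∧ (1 / 2 : ℝ) ^ a ≤ 1 :=
  ⟨by positivity, pow_le_one₀ (by norm_num) (by norm_num)⟩

lemma deviation_nil (d : List ℕ) (a : ℕ) : deviation d a [] = 0 := by
  simp [deviation, occ_nil_right]

lemma abs_deviation_le_length (d : List ℕ) (a : ℕ) (c : List ℕ) :
    |deviation d a c| ≤ c.length := by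
  have h1 : (occ (d ++ [a]) c : ℝ) ≤ c.length := by exact_mod_cast occ_le_length _ c
  have h2 : (occ d c : ℝ) ≤ c.length := by exact_mod_cast occ_le_length _ c
  have h3 : (0 : ℝ) ≤ occ (d ++ [a]) c := by positivity
  have h4 : (0 : ℝ) ≤ occ d c := by positivity
  obtain ⟨h5, h6⟩ := half_pow_mem a
  rw [deviation, abs_le]
  constructor <;> nlinarith

lemma abs_deviation_append_le (d : List ℕ) (a : ℕ) (x y : List ℕ) :
    |deviation d a (x ++ y)| ≤ |deviation d a x| + (d.length + 1) + |deviation d a y| := by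
  obtain ⟨h1, h2⟩ := occ_append (d ++ [a]) x y
  obtain ⟨h3, h4⟩ := occ_append d x y
  have h2' := h2.trans (Nat.add_le_add_left (min_le_right _ _) _)
  have h4' := h4.trans (Nat.add_le_add_left (min_le_right _ _) _)
  rw [List.length_append, List.length_singleton] at h2'
  have g1 : (occ (d ++ [a]) x + occ (d ++ [a]) y : ℝ) ≤ occ (d ++ [a]) (x ++ y) := by
    exact_mod_cast h1
  have g2 : (occ (d ++ [a]) (x ++ y) : ℝ) ≤
      occ (d ++ [a]) x + occ (d ++ [a]) y + (d.length + 1) := by exact_mod_cast h2'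
  have g3 : (occ d x + occ d y : ℝ) ≤ occ d (x ++ y) := by exact_mod_cast h3
  have g4 : (occ d (x ++ y) : ℝ) ≤ occ d x + occ d y + d.length := by exact_mod_cast h4'
  have g0 : (0 : ℝ) ≤ d.length := by positivity
  obtain ⟨h5, h6⟩ := half_pow_mem a
  have : |deviation d a (x ++ y) - (deviation d a x + deviation d a y)| ≤ d.length + 1 := by
    rw [deviation, deviation, deviation, abs_le]
    constructor <;> nlinarith
  have t1 := abs_add_le (deviation d a (x ++ y) - (deviation d a x + deviation d a y))
    (deviation d a x + deviation d a y)
  have t2 := abs_add_le (deviation d a x) (deviation d a y)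
  rw [sub_add_cancel] at t1
  linarith

/-- Every complete list costs its deviation and a seam term, the cut one at most its length. Lists
beyond the cut only enlarge the bound. -/
lemma abs_deviation_take_flatten_le (d : List ℕ) (a : ℕ) {B : ℕ} {cs : List (List ℕ)}
    (hB : ∀ c ∈ cs, c.length ≤ B) (n : ℕ) :
    |deviation d a (cs.flatten.take n)| ≤
      (cs.map fun c => |deviation d a c| + (d.length + 1)).sum + B := by
  induction cs generalizing n with
  | nil => simp [deviation_nil]
  | cons c cs ih =>
    have ih' := ih (fun b hb => hB b (List.mem_cons_of_mem _ hb))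
    rw [List.flatten_cons, List.map_cons, List.sum_cons, List.take_append]
    by_cases h : n ≤ c.length
    · rw [Nat.sub_eq_zero_of_le h, List.take_zero, List.append_nil]
      have h1 := abs_deviation_le_length d a (c.take n)
      have h2 : ((c.take n).length : ℝ) ≤ B := by
        exact_mod_cast (List.length_take_le' n c).trans (hB c List.mem_cons_self)
      have h3 : 0 ≤ (cs.map fun c => |deviation d a c| + ((d.length : ℝ) + 1)).sum := by
        refine List.sum_nonneg fun x hx => ?_
        obtain ⟨b, -, rfl⟩ := List.mem_map.1 hx
        positivity
      have h4 : 0 ≤ |deviation d a c| + ((d.length : ℝ) + 1) := by positivity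
      linarith
    · rw [List.take_of_length_le (not_le.1 h).le]
      have := abs_deviation_append_le d a c (cs.flatten.take (n - c.length))
      linarith [ih' (n - c.length)]

/-! ### A martingale on the Farey tree -/

lemma append_singleton_suffix_iff {d u : List ℕ} {a r : ℕ} :
    d ++ [a] <:+ u ++ [r] ↔ a = r ∧ d <:+ u := by
  rw [List.suffix_concat_iff]
  constructor
  · rintro (h | ⟨t, h, ht⟩)
    · simp at h
    · obtain ⟨rfl, h⟩ := List.append_inj' h rfl
      exact ⟨by simpa using h, ht⟩
  · rintro ⟨rfl, h⟩
    exact .inr ⟨d, rfl, h⟩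

lemma deviation_concat (d : List ℕ) (a : ℕ) (u : List ℕ) (r : ℕ) :
    deviation d a (u ++ [r]) = deviation d a u + (if d <:+ u ∧ a = r then 1 else 0) -
      (if d <:+ u ++ [r] then (1 / 2) ^ a else 0) := by
  rw [deviation, deviation, occ_concat, occ_concat]
  simp only [append_singleton_suffix_iff, and_comm]
  push_cast
  split_ifs <;> ring

/-- The probability that a digit with `r` units so far, following `u`, completes an occurrence of
`d, a`, when each further unit belongs to the same digit with probability `1 / 2`. -/
noncomputable def pending (d : List ℕ) (a : ℕ) (u : List ℕ) (r : ℕ) : ℝ :=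
  if d <:+ u ∧ r ≤ a then (1 / 2) ^ (a + 1 - r) else 0

lemma pending_mem (d : List ℕ) (a : ℕ) (u : List ℕ) (r : ℕ) :
    0 ≤ pending d a u r ∧ pending d a u r ≤ 1 := by
  unfold pending
  split_ifs
  · exact half_pow_mem _
  · exact ⟨le_rfl, zero_le_one⟩

/-- The deviation of a node `u, r + 1` of the Farey tree, corrected for its last digit so that it
becomes a martingale along the tree. -/
noncomputable def martingaleDev (d : List ℕ) (a : ℕ) (u : List ℕ) (r : ℕ) : ℝ :=
  deviation d a u + pending d a u r

/-- The martingale property. If the digit stays open, the chance of completing `d, a` doubles as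
long as `r < a`; if it closes, the outcome is decided. A digit opened after `d` has chance `2^{-a}`,
which cancels the share subtracted in `deviation` for that `d`. -/
lemma martingaleDev_add (d : List ℕ) {a : ℕ} (ha : 1 ≤ a) (u : List ℕ) (r : ℕ) :
    martingaleDev d a u (r + 1) + martingaleDev d a (u ++ [r]) 1 = 2 * martingaleDev d a u r := by
  have h1 : pending d a (u ++ [r]) 1 = if d <:+ u ++ [r] then (1 / 2) ^ a else 0 := by
    simp [pending, ha]
  have h2 : pending d a u (r + 1) + (if d <:+ u ∧ a = r then 1 else 0) = 2 * pending d a u r := by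
    unfold pending
    by_cases hd : d <:+ u
    · simp only [hd, true_and]
      rcases lt_trichotomy r a with h | rfl | h
      · obtain ⟨k, rfl⟩ := Nat.exists_eq_add_of_lt h
        rw [if_pos (by omega), if_neg (by omega), if_pos h.le,
          show r + k + 1 + 1 - (r + 1) = k + 1 by omega,
          show r + k + 1 + 1 - r = k + 1 + 1 by omega, pow_succ _ (k + 1)]
        ring
      · norm_num
      · rw [if_neg (by omega), if_neg (by omega), if_neg (by omega)]
        norm_num
    · simp [hd]
  rw [martingaleDev, martingaleDev, martingaleDev, deviation_concat, h1]
  linarith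

/-- The children have values `m ± δ` around the parent's `m`, with squares summing to `2m² + 2δ²`.
The child that keeps `u` changes only `pending`, so `|δ| ≤ 1`. -/
lemma martingaleDev_sq_add_sq_le (d : List ℕ) {a : ℕ} (ha : 1 ≤ a) (u : List ℕ) (r : ℕ) :
    martingaleDev d a u (r + 1) ^ 2 + martingaleDev d a (u ++ [r]) 1 ^ 2 ≤
      2 * martingaleDev d a u r ^ 2 + 2 := by
  have h := martingaleDev_add d ha u r
  have h1 : (martingaleDev d a u (r + 1) - martingaleDev d a u r) ^ 2 ≤ 1 := by
    have h2 := pending_mem d a u r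
    have h3 := pending_mem d a u (r + 1)
    rw [martingaleDev, martingaleDev, sq_le_one_iff_abs_le_one, abs_le]
    constructor <;> linarith
  have h4 : martingaleDev d a (u ++ [r]) 1 =
      2 * martingaleDev d a u r - martingaleDev d a u (r + 1) := by linarith
  rw [h4]
  linarith

lemma abs_deviation_concat_le (d : List ℕ) (a : ℕ) (u : List ℕ) (r s : ℕ) :
    |deviation d a (u ++ [s])| ≤ |martingaleDev d a u r| + 2 := by
  have h1 := pending_mem d a u r
  have h2 := half_pow_mem a
  have h3 : |deviation d a (u ++ [s]) - martingaleDev d a u r| ≤ 2 := by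
    rw [deviation_concat, martingaleDev, abs_le]
    split_ifs <;> constructor <;> linarith
  have := abs_sub_abs_le_abs_sub (deviation d a (u ++ [s])) (martingaleDev d a u r)
  linarith

/-! ### The levels of the Farey tree -/

lemma incrLast_concat (u : List ℕ) (r : ℕ) : incrLast (u ++ [r]) = u ++ [r + 1] := by
  simp [incrLast]

lemma splitLast_concat (u : List ℕ) (r : ℕ) : splitLast (u ++ [r]) = u ++ [r - 1] ++ [2] := by
  simp [splitLast]

lemma mem_fareyLevel {l : ℕ} {c : List ℕ} (hc : c ∈ fareyLevel l) :
    ∃ u r, c = u ++ [r + 1] ∧ 1 ≤ r ∧ (∀ x ∈ u, 1 ≤ x) ∧ u.length ≤ l := by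
  induction l generalizing c with
  | zero => exact ⟨[], 1, by simpa [fareyLevel] using hc, le_rfl, by simp, le_rfl⟩
  | succ l ih =>
    rw [fareyLevel, List.mem_flatMap] at hc
    obtain ⟨b, hb, hc⟩ := hc
    obtain ⟨u, r, rfl, hr, hu, hl⟩ := ih hb
    have : c = incrLast (u ++ [r + 1]) ∨ c = splitLast (u ++ [r + 1]) := by
      unfold fareyChildren at hc
      split_ifs at hc <;> simp at hc <;> tauto
    rcases this with rfl | rfl
    · exact ⟨u, r + 1, incrLast_concat _ _, by omega, hu, by omega⟩
    · refine ⟨u ++ [r], 1, splitLast_concat _ _, le_rfl, fun x hx => ?_, by simpa using hl⟩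
      rcases List.mem_append.1 hx with h | h
      · exact hu x h
      · rw [List.mem_singleton] at h; omega

/-- Sums over a level ignore the order of the children, so the parity rule disappears here. -/
lemma sum_map_fareyLevel_succ {M : Type*} [AddCommMonoid M] (g : List ℕ → M) (l : ℕ) :
    ((fareyLevel (l + 1)).map g).sum =
      ((fareyLevel l).map fun c => g (incrLast c) + g (splitLast c)).sum := by
  rw [fareyLevel]
  induction fareyLevel l with
  | nil => simp
  | cons c t ih =>
    rw [List.flatMap_cons, List.map_append, List.sum_append, ih, List.map_cons, List.sum_cons]
    congr 1
    unfold fareyChildren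
    split_ifs
    · simp
    · simp [add_comm]

lemma sum_length_fareyLevel (l : ℕ) :
    2 * ((fareyLevel l).map List.length).sum = 2 ^ l * (l + 2) := by
  have key : ∀ l, ((fareyLevel l).map fun _ => 1).sum = 2 ^ l := by
    intro l
    induction l with
    | zero => simp [fareyLevel]
    | succ l ih => rw [sum_map_fareyLevel_succ, List.sum_map_add, ih, pow_succ]; omega
  induction l with
  | zero => simp [fareyLevel]
  | succ l ih =>
    have : ((fareyLevel l).map fun c => (incrLast c).length + (splitLast c).length) =
        (fareyLevel l).map fun c => c.length + c.length + 1 := by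
      refine List.map_congr_left fun c hc => ?_
      obtain ⟨u, r, rfl, -⟩ := mem_fareyLevel hc
      rw [incrLast_concat, splitLast_concat]
      simp
      omega
    rw [sum_map_fareyLevel_succ, this, List.sum_map_add, List.sum_map_add, key, pow_succ]
    linarith

/-- `martingaleDev` as a function of the node. -/
noncomputable def nodeDev (d : List ℕ) (a : ℕ) (c : List ℕ) : ℝ :=
  martingaleDev d a c.dropLast (c.getLastD 0 - 1)

lemma nodeDev_concat (d : List ℕ) (a : ℕ) (u : List ℕ) (r : ℕ) :
    nodeDev d a (u ++ [r + 1]) = martingaleDev d a u r := by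
  simp [nodeDev]

lemma sum_nodeDev_sq_le (d : List ℕ) {a : ℕ} (ha : 1 ≤ a) (l : ℕ) :
    ((fareyLevel l).map fun c => nodeDev d a c ^ 2).sum ≤ 2 ^ l * ((l : ℝ) + 1) := by
  have hone : ∀ l, ((fareyLevel l).map fun _ => (2 : ℝ)).sum = 2 * 2 ^ l := by
    intro l
    induction l with
    | zero => simp [fareyLevel]
    | succ l ih => rw [sum_map_fareyLevel_succ, List.sum_map_add, ih]; ring
  induction l with
  | zero =>
    have := pending_mem d a [] 1
    have h : nodeDev d a [2] = pending d a [] 1 := by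
      rw [← zero_add (pending d a [] 1), ← deviation_nil d a]
      exact nodeDev_concat d a [] 1
    simp only [fareyLevel, List.map_cons, List.map_nil, List.sum_cons, List.sum_nil, h]
    norm_num
    rw [abs_le]
    constructor <;> linarith
  | succ l ih =>
    rw [sum_map_fareyLevel_succ]
    have h : ((fareyLevel l).map fun c =>
        nodeDev d a (incrLast c) ^ 2 + nodeDev d a (splitLast c) ^ 2).sum ≤
        ((fareyLevel l).map fun c => 2 * nodeDev d a c ^ 2 + 2).sum := by
      refine List.sum_le_sum fun c hc => ?_
      obtain ⟨u, r, rfl, -⟩ := mem_fareyLevel hc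
      rw [incrLast_concat, splitLast_concat, nodeDev_concat, nodeDev_concat, nodeDev_concat,
        add_tsub_cancel_right]
      exact martingaleDev_sq_add_sq_le d ha u r
    refine h.trans ?_
    rw [List.sum_map_add, hone, List.sum_map_mul_left]
    push_cast
    rw [pow_succ]
    linarith

/-- From mean square to mean absolute value by `|x| ≤ x² / t + t`. A large fixed `t` makes `(l + 1)
/ t` a small fraction of the mean length. -/
lemma sum_abs_deviation_fareyLevel_le (d : List ℕ) {a : ℕ} (ha : 1 ≤ a) (l : ℕ) {t : ℝ}
    (ht : 0 < t) (K : ℝ) : ((fareyLevel l).map fun c => |deviation d a c| + K).sum ≤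
      2 ^ l * (((l : ℝ) + 1) / t + t + 2 + K) := by
  have hone : ∀ l, ((fareyLevel l).map fun _ => t + 2 + K).sum = 2 ^ l * (t + 2 + K) := by
    intro l
    induction l with
    | zero => simp [fareyLevel]
    | succ l ih => rw [sum_map_fareyLevel_succ, List.sum_map_add, ih]; ring
  have h : ((fareyLevel l).map fun c => |deviation d a c| + K).sum ≤
      ((fareyLevel l).map fun c => t⁻¹ * nodeDev d a c ^ 2 + (t + 2 + K)).sum := by
    refine List.sum_le_sum fun c hc => ?_
    obtain ⟨u, r, rfl, -⟩ := mem_fareyLevel hc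
    rw [nodeDev_concat]
    have h1 := abs_deviation_concat_le d a u r (r + 1)
    have h2 : |martingaleDev d a u r| ≤ t⁻¹ * martingaleDev d a u r ^ 2 + t := by
      rw [← sq_abs (martingaleDev d a u r)]
      generalize |martingaleDev d a u r| = x
      have : t⁻¹ * x ^ 2 + t - x = t⁻¹ * ((x - t / 2) ^ 2 + 3 / 4 * t ^ 2) := by
        field_simp
        ring
      have : 0 ≤ t⁻¹ * ((x - t / 2) ^ 2 + 3 / 4 * t ^ 2) := by positivity
      linarith
    linarith
  refine h.trans ?_
  rw [List.sum_map_add, hone, List.sum_map_mul_left]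
  have h3 := mul_le_mul_of_nonneg_left (sum_nodeDev_sq_le d ha l) (inv_nonneg.2 ht.le)
  have h4 : t⁻¹ * (2 ^ l * ((l : ℝ) + 1)) = 2 ^ l * (((l : ℝ) + 1) / t) := by ring
  linarith

/-! ### The concatenation of the levels -/

/-- The nodes of the levels `0, …, L - 1`, top-down, left-right. -/
def fareyNodes (L : ℕ) : List (List ℕ) := (List.range L).flatMap fareyLevel

lemma fareyNodes_succ (L : ℕ) : fareyNodes (L + 1) = fareyNodes L ++ fareyLevel L := by
  simp [fareyNodes, List.range_succ]

lemma fareyPrefix_eq_flatten (L : ℕ) : fareyPrefix L = (fareyNodes L).flatten := by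
  induction L with
  | zero => rfl
  | succ L ih => rw [fareyPrefix, fareyNodes_succ, List.flatten_append, ih]

lemma length_le_of_mem_fareyNodes {L : ℕ} {c : List ℕ} (hc : c ∈ fareyNodes L) :
    c.length ≤ L := by
  obtain ⟨l, hl, hc⟩ := List.mem_flatMap.1 hc
  obtain ⟨u, r, rfl, -, -, hu⟩ := mem_fareyLevel hc
  have := List.mem_range.1 hl
  simp
  omega

lemma one_le_of_mem_fareyPrefix {L x : ℕ} (hx : x ∈ fareyPrefix L) : 1 ≤ x := by
  rw [fareyPrefix_eq_flatten] at hx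
  obtain ⟨c, hc, hx⟩ := List.mem_flatten.1 hx
  obtain ⟨l, -, hc⟩ := List.mem_flatMap.1 hc
  obtain ⟨u, r, rfl, hr, hu, -⟩ := mem_fareyLevel hc
  rcases List.mem_append.1 hx with h | h
  · exact hu x h
  · rw [List.mem_singleton] at h; omega

/-- The level sizes add up to less than `2^L`, and `(l + 1) / t ≤ L / t` on each level `l < L`. -/
lemma sum_abs_deviation_fareyNodes_le (d : List ℕ) {a : ℕ} (ha : 1 ≤ a) (L : ℕ) {t : ℝ}
    (ht : 0 < t) {K : ℝ} (hK : 0 ≤ K) : ((fareyNodes L).map fun c => |deviation d a c| + K).sum ≤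
      2 ^ L * ((L : ℝ) / t + t + 2 + K) := by
  induction L with
  | zero =>
    simp only [fareyNodes, List.range_zero, List.flatMap_nil, List.map_nil, List.sum_nil]
    positivity
  | succ L ih =>
    rw [fareyNodes_succ, List.map_append, List.sum_append]
    have h1 := sum_abs_deviation_fareyLevel_le d ha L ht K
    have h2 : (L : ℝ) / t ≤ ((L : ℝ) + 1) / t := by gcongr; linarith
    have h3 : (0 : ℝ) < 2 ^ L := by positivity
    push_cast
    rw [pow_succ]
    nlinarith

lemma fareyPrefix_prefix {L M : ℕ} (h : L ≤ M) : fareyPrefix L <+: fareyPrefix M := by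
  induction M, h using Nat.le_induction with
  | base => exact List.prefix_rfl
  | succ M _ ih => exact ih.trans (List.prefix_append _ _)

lemma le_length_fareyPrefix (M : ℕ) :
    2 ^ M * (M + 2) ≤ 2 * (fareyPrefix (M + 1)).length := by
  rw [fareyPrefix, List.length_append, List.length_flatten, ← sum_length_fareyLevel]
  omega

lemma fareyDigit_eq {n L : ℕ} (h : n < (fareyPrefix L).length) :
    fareyDigit n = (fareyPrefix L)[n] := by
  have h' := lt_length_fareyPrefix n
  rw [fareyDigit, List.getD_eq_getElem _ _ h']
  rcases le_total L (n + 1) with hL | hL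
  · exact ((fareyPrefix_prefix hL).getElem h).symm
  · exact (fareyPrefix_prefix hL).getElem h'

lemma one_le_fareyDigit (n : ℕ) : 1 ≤ fareyDigit n := by
  rw [fareyDigit_eq (lt_length_fareyPrefix n)]
  exact one_le_of_mem_fareyPrefix (List.getElem_mem _)

lemma map_fareyDigit_range {n L : ℕ} (h : n ≤ (fareyPrefix L).length) :
    (List.range n).map fareyDigit = (fareyPrefix L).take n := by
  refine List.ext_getElem (by simpa using h) fun i h1 h2 => ?_
  rw [List.getElem_map, List.getElem_range, List.getElem_take, fareyDigit_eq]

/-! ### Block frequencies in the concatenation -/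

lemma abs_deviation_fareyDigit_le (d : List ℕ) {a : ℕ} (ha : 1 ≤ a) {ε : ℝ} (hε : 0 < ε) :
    ∃ N : ℕ, ∀ n ≥ N, |deviation d a ((List.range n).map fareyDigit)| ≤ ε * n := by
  -- With `t = 16 / ε`, from `L₀` on the bounded terms are at most `L / t`; the `3` is the `2` of
  -- the level bound plus `1` for the cut expansion.
  obtain ⟨L₀, hL₀⟩ := exists_nat_ge ((16 / ε + 3 + (d.length + 1)) * (16 / ε))
  refine ⟨(fareyPrefix (L₀ + 1)).length, fun n hn => ?_⟩
  have hex : ∃ L, n < (fareyPrefix L).length := ⟨n + 1, lt_length_fareyPrefix n⟩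
  classical
  have hL := Nat.find_spec hex
  have hmin : ∀ {m : ℕ}, m < Nat.find hex → (fareyPrefix m).length ≤ n :=
    fun h => not_lt.1 (Nat.find_min hex h)
  generalize Nat.find hex = L at hL hmin
  have hLL : L₀ + 2 ≤ L := by
    by_contra! h
    have := (fareyPrefix_prefix (show L ≤ L₀ + 1 by omega)).length_le
    omega
  -- The prefix ends within level `M + 1` and contains all of level `M`, so `n ≥ 2^M (M + 2) / 2`.
  -- Bounding all levels up to `M + 1` loses only a constant factor.
  obtain ⟨M, rfl⟩ : ∃ M, L = M + 2 := ⟨L - 2, by omega⟩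
  have h1 := (le_length_fareyPrefix M).trans (Nat.mul_le_mul_left 2 (hmin (by omega)))
  have h1' : (2 : ℝ) ^ M * (M + 2) ≤ 2 * n := by exact_mod_cast h1
  rw [map_fareyDigit_range hL.le, fareyPrefix_eq_flatten]
  have h2 := abs_deviation_take_flatten_le d a
    (fun c hc => length_le_of_mem_fareyNodes (L := M + 2) hc) n
  have h3 := sum_abs_deviation_fareyNodes_le d ha (M + 2) (t := 16 / ε) (by positivity)
    (K := (d.length : ℝ) + 1) (by positivity)
  have h4 : ((M + 2 : ℕ) : ℝ) ≤ 2 ^ (M + 2) := by exact_mod_cast (Nat.lt_two_pow_self).le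
  have h5 : (L₀ : ℝ) ≤ ((M + 2 : ℕ) : ℝ) := by exact_mod_cast (by omega : L₀ ≤ M + 2)
  have h6 : 16 / ε + 3 + (d.length + 1) ≤ ((M + 2 : ℕ) : ℝ) / (16 / ε) :=
    (le_div_iff₀ (by positivity)).2 (hL₀.trans h5)
  have h7 : ((M + 2 : ℕ) : ℝ) / (16 / ε) = ε / 16 * ((M : ℝ) + 2) := by
    push_cast
    field_simp
  have hp : (0 : ℝ) < 2 ^ (M + 2) := by positivity
  calc |deviation d a ((fareyNodes (M + 2)).flatten.take n)|
      ≤ 2 ^ (M + 2) * (((M + 2 : ℕ) : ℝ) / (16 / ε) + (16 / ε + 3 + (d.length + 1))) := by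
        linarith
    _ ≤ 2 ^ (M + 2) * (ε / 16 * ((M : ℝ) + 2) + ε / 16 * ((M : ℝ) + 2)) := by
        rw [← h7]; gcongr
    _ = ε / 2 * (2 ^ M * ((M : ℝ) + 2)) := by rw [pow_add]; ring
    _ ≤ ε / 2 * (2 * n) := by gcongr
    _ = ε * n := by ring

lemma tendsto_deviation_fareyDigit (d : List ℕ) {a : ℕ} (ha : 1 ≤ a) :
    Tendsto (fun n : ℕ => deviation d a ((List.range n).map fareyDigit) / n) atTop (𝓝 0) := by
  refine Metric.tendsto_atTop.2 fun ε hε => ?_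
  obtain ⟨N, hN⟩ := abs_deviation_fareyDigit_le d ha (half_pos hε)
  refine ⟨N, fun n hn => ?_⟩
  rw [Real.dist_eq, sub_zero, abs_div, Nat.abs_cast]
  refine (div_le_of_le_mul₀ (by positivity) (by positivity) (hN n hn)).trans_lt (half_lt_self hε)

/-- The empty block has frequency `1`, and each appended digit `a` multiplies the frequency by
`2^{-a}`. -/
lemma tendsto_occ_fareyDigit {d : List ℕ} (hd : ∀ a ∈ d, 0 < a) :
    Tendsto (fun n : ℕ => (occ d ((List.range n).map fareyDigit) : ℝ) / n) atTop
      (𝓝 ((1 / 2) ^ d.sum)) := by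
  induction d using List.reverseRecOn with
  | nil =>
    refine tendsto_const_nhds.congr' ?_
    filter_upwards [eventually_gt_atTop 0] with n hn
    have : (n : ℝ) ≠ 0 := by positivity
    simp [occ_nil_left, this]
  | append_singleton d a ih =>
    have h1 := ih fun b hb => hd b (List.mem_append_left _ hb)
    have h2 := tendsto_deviation_fareyDigit d (hd a (by simp))
    have h3 := h2.add (h1.const_mul ((1 / 2) ^ a))
    rw [zero_add, ← pow_add] at h3
    rw [List.sum_append, List.sum_singleton, add_comm]
    refine h3.congr fun n => ?_
    rw [deviation]
    ring

/-! ### Counting by first and by last position -/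

lemma suffix_map_range_iff (w : ℕ → ℕ) (d : List ℕ) (m : ℕ) : d <:+ (List.range m).map w ↔
    d.length ≤ m ∧ ∀ j < d.length, w (m - d.length + j) = d.getD j 0 := by
  constructor
  · intro h
    have hl : d.length ≤ m := by simpa using h.length_le
    refine ⟨hl, fun j hj => ?_⟩
    rw [List.getD_eq_getElem _ _ hj, h.getElem hj]
    simp
  · rintro ⟨hl, h⟩
    rw [List.suffix_iff_eq_drop]
    refine List.ext_getElem (by simp; omega) fun j h1 h2 => ?_
    have := h j h1
    rw [List.getD_eq_getElem _ _ h1] at this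
    simp [← this]

lemma blockCount_eq_occ (n : ℕ) (x : ℝ) {d : List ℕ} (hd : d ≠ []) :
    blockCount n x d = occ d ((List.range n).map (cfDigit x)) := by
  have hpos := List.length_pos_iff.2 hd
  have htake : ∀ i < n, ((List.range n).map (cfDigit x)).take (i + 1) =
      (List.range (i + 1)).map (cfDigit x) := by
    intro i hi
    rw [← List.map_take, List.take_range, min_eq_left (by omega)]
  unfold blockCount occ
  -- First and last position differ by `d.length - 1`; truncated subtraction is harmless as `d` is
  -- nonempty.
  refine Finset.card_nbij' (fun i => i + d.length - 1) (fun i => i + 1 - d.length) ?_ ?_ ?_ ?_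
  · intro i hi
    simp only [Finset.coe_filter, Finset.mem_range, Set.mem_ofPred_eq, List.length_map,
      List.length_range] at hi ⊢
    obtain ⟨-, h1, h2⟩ := hi
    refine ⟨by omega, ?_⟩
    rw [htake _ (by omega), suffix_map_range_iff]
    refine ⟨by omega, fun j hj => ?_⟩
    rw [← h2 j hj]
    congr 1
    omega
  · intro i hi
    simp only [Finset.coe_filter, Finset.mem_range, Set.mem_ofPred_eq, List.length_map,
      List.length_range] at hi ⊢
    obtain ⟨h1, h2⟩ := hi
    rw [htake _ h1, suffix_map_range_iff] at h2
    exact ⟨by omega, by omega, h2.2⟩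
  · intro i hi
    simp only [Finset.coe_filter, Finset.mem_range, Set.mem_ofPred_eq] at hi
    dsimp only
    omega
  · intro i hi
    simp only [Finset.coe_filter, Finset.mem_range, Set.mem_ofPred_eq, List.length_map,
      List.length_range] at hi
    obtain ⟨h1, h2⟩ := hi
    rw [htake _ h1, suffix_map_range_iff] at h2
    dsimp only
    omega

end MinkowskiNormality

theorem mainTheorem3 :
    -- the convergents of the concatenated continued fraction converge to `fareyNumber`,
    Tendsto MinkowskiNormality.fareyConvergent atTop (𝓝 MinkowskiNormality.fareyNumber) ∧
    -- which is an irrational number with the concatenation as its expansion,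
    Irrational MinkowskiNormality.fareyNumber ∧
    (∀ n : ℕ, MinkowskiNormality.cfDigit MinkowskiNormality.fareyNumber n =
      MinkowskiNormality.fareyDigit n) ∧
    -- and which is Minkowski normal
    MinkowskiNormality.MinkowskiNormal MinkowskiNormality.fareyNumber := by
  open MinkowskiNormality in
  -- `fareyNumber` is `cfLim fareyDigit` by definition.
  have hdigit : ∀ n, cfDigit fareyNumber n = fareyDigit n := cfDigit_cfLim one_le_fareyDigit
  refine ⟨tendsto_cfLim one_le_fareyDigit, irrational_cfLim one_le_fareyDigit, hdigit,
    Set.Ioo_subset_Ico_self (cfLim_mem_Ioo one_le_fareyDigit), fun d hd hpos => ?_⟩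
  have hmeas := questionMeasure_cylinder hpos
  refine ⟨?_, hmeas⟩
  rw [hmeas, ENNReal.toReal_ofReal (by positivity)]
  refine (tendsto_occ_fareyDigit hpos).congr fun n => ?_
  rw [blockCount_eq_occ n _ hd, funext hdigit]
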